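/- Let $\mathcal T=(S,\kappa,\mathrm{AP},\mathcal L)$ be a labelled denumerable Markov chain: $S$ is a countable set with the $\sigma$-algebra $2^S$, $\kappa$ is a Markov kernel on $S$, $\mathrm{AP}$ is a finite set and $\mathcal L:S\to 2^{\mathrm{AP}}$. Let $\mathcal M=(Q,q_0,E,\mathcal F)$ be a deterministic and complete Muller automaton over $\mathrm{AP}$: $Q$ is finite, $q_0\in Q$, $\mathcal F\subseteq 2^Q$, and $E\subseteq Q\times 2^{\mathrm{AP}}\times Q$ contains, for all $q\in Q$ and $u\subseteq \mathrm{AP}$, exactly one edge $(q,u,q')$. The product $\mathcal T\ltimes\mathcal M$ is the Markov chain on $S\times Q$ with $\kappa'((s,q),A\times\{q'\})=\kappa(s,A)$ if $(q,\mathcal L(s),q')\in E$ and $0$ otherwise, in which $(s,q)$ is labelled by $q$. For a Markov chain on a countable set $X$ and a distribution $\nu$ on $X$, let $\mathrm{Prob}_\nu$ be the induced probability measure on the infinite paths with initial distribution $\nu$, and for $D\subseteq X$ let $\mathbf F D$ be the event that $D$ is eventually visited; $D$ is an attractor if $\mathrm{Prob}_\nu(\mathbf F D)=1$ for every distribution $\nu$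 on $X$. For $B\subseteq S\times Q$, let $\mathsf{Graph}(B)$ be the directed graph with vertex set $B$ and an edge from $x$ to $y$ whenever there is a finite path from $x$ to $y$ in $\mathcal T\ltimes\mathcal M$ all of whose steps have positive probability. A bottom strongly connected component (BSCC) of a directed graph is a strongly connected component that no edge leaves. A BSCC $C$ of $\mathsf{Graph}(B)$ is good, written $C\in\mathsf{Good}^B(\mathcal F)$, if there is $F\in\mathcal F$ such that (a) whenever some $(s,q)$ is reachable from $C$ by such a path, then $q\in F$, and (b) for every $q\in F$ there is $s\in S$ such that $(s,q)$ is reachable from $C$ by such a path. Assume that $\mathcal T$ has a finite attractor. Then $\mathcal T\ltimes\mathcal M$ has a finite attractor, and for every attractor $B$ of $\mathcal T\ltimes\mathcal M$ and every distribution $\mu$ on $S$, \[ \mathrm{Prob}^{\mathcal T\ltimes\mathcal M}_{\mu\times\delta_{q_0}}(\mathsf{Inf}\in\mathcal F)=\sum_{C\in\mathsf{Good}^B(\mathcal F)}\mathrm{Prob}^{\mathcal T\ltimes\mathcal M}_{\mu\times\delta_{q_0}}(\mathbf F C), \] where $\mathsf{Inf}\in\mathcal F$ is the event that the set of locations $q\in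 Q$ visited infinitely often belongs to $\mathcal F$. -/

import Mathlib

open MeasureTheory ProbabilityTheory
open scoped ENNReal

noncomputable section

/-- A labelled stochastic transition system on the measurable space `S`: a Markov kernel on `S`
together with a measurable labelling of the states by sets of atomic propositions. -/
structure LSTS (S AP : Type*) [MeasurableSpace S] where
  kernel : Kernel S S
  isMarkov : IsMarkovKernel kernel
  label : S → Set AP
  measurable_label : Measurable label

namespace LSTS

variable {S AP : Type*} [MeasurableSpace S] (T : LSTS S AP)

instance : IsMarkovKernel T.kernel := T.isMarkov

/-- The kernel giving the law of the state at time `n + 1` from the history up to time `n`: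
it only looks at the state at time `n`. -/
def historyKernel (n : ℕ) : Kernel (Finset.Iic n → S) S :=
  T.kernel.comap (fun h => h ⟨n, Finset.mem_Iic.mpr le_rfl⟩) (measurable_pi_apply _)

instance (n : ℕ) : IsMarkovKernel (T.historyKernel n) := by
  unfold historyKernel; infer_instance

/-- The probability measure on infinite paths with initial distribution `μ`. -/
def prob (μ : Measure S) : Measure (ℕ → S) :=
  Kernel.trajMeasure (X := fun _ => S) μ T.historyKernel

/-- The set of infinite paths that eventually visit `B`. -/
def eventually (B : Set S) : Set (ℕ → S) := {ρ | ∃ n, ρ n ∈ B}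

/-- The atomic propositions that hold infinitely often along a path. -/
def inf (ρ : ℕ → S) : Set AP := {a | {j : ℕ | a ∈ T.label (ρ j)}.Infinite}

/-- The set of infinite paths that satisfy the Muller condition `𝓕`. -/
def muller (𝓕 : Set (Set AP)) : Set (ℕ → S) := {ρ | T.inf ρ ∈ 𝓕}

/-- `B` is almost surely reached from every initial distribution. -/
def IsAttractor (B : Set S) : Prop :=
  MeasurableSet B ∧
    ∀ μ : Measure S, IsProbabilityMeasure μ → T.prob μ (eventually B) = 1

/-- There is a finite path from `x` to `y`, each of whose steps has positive probability. -/
def Reach (x y : S) : Prop :=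
  Relation.ReflTransGen (fun s t => 0 < T.kernel s {t}) x y

/-- The graph of `B`: its vertices are the states in `B`, and there is an edge from `x` to `y`
if there is a path from `x` to `y` in the transition system (possibly leaving `B`). -/
def graph (B : Set S) : Digraph B where
  Adj x y := T.Reach x y

end LSTS

/-- `C` is a strongly connected component of the directed graph `G`. -/
def Digraph.IsSCC {V : Type*} (G : Digraph V) (C : Set V) : Prop :=
  C.Nonempty ∧ ∀ x ∈ C, ∀ y,
    y ∈ C ↔ Relation.ReflTransGen G.Adj x y ∧ Relation.ReflTransGen G.Adj y x

/-- `C` is a bottom strongly connected component of `G`: one that no edge leaves. -/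
def Digraph.IsBSCC {V : Type*} (G : Digraph V) (C : Set V) : Prop :=
  G.IsSCC C ∧ ∀ x ∈ C, ∀ y, G.Adj x y → y ∈ C

/-- A deterministic and complete Muller automaton over `AP` with set of locations `Q`. -/
structure DMA (AP Q : Type*) where
  init : Q
  edges : Set (Q × Set AP × Q)
  acc : Set (Set Q)
  deterministic : ∀ q u q₁ q₂, (q, u, q₁) ∈ edges → (q, u, q₂) ∈ edges → q₁ = q₂
  complete : ∀ q u, ∃ q', (q, u, q') ∈ edges

namespace DMA

variable {AP Q : Type*} (M : DMA AP Q)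

/-- The unique location reached from `q` by reading `u`. -/
def next (q : Q) (u : Set AP) : Q := (M.complete q u).choose

theorem next_eq_iff (q : Q) (u : Set AP) (q' : Q) : M.next q u = q' ↔ (q, u, q') ∈ M.edges :=
  ⟨fun h => h ▸ (M.complete q u).choose_spec,
    fun h => M.deterministic q u _ _ (M.complete q u).choose_spec h⟩

end DMA

namespace LSTS

variable {S AP Q : Type*} [MeasurableSpace S] [Finite AP]
  [Finite Q] [MeasurableSpace Q] [DiscreteMeasurableSpace Q]

theorem measurable_next (T : LSTS S AP) (M : DMA AP Q) :
    Measurable fun x : S × Q => M.next x.2 (T.label x.1) := by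
  have h : Measurable fun p : Q × Set AP => M.next p.1 p.2 := measurable_of_countable _
  exact h.comp (measurable_snd.prodMk (T.measurable_label.comp measurable_fst))

/-- The product of `T` with `M`: from `(s, q)` the first component moves according to the kernel
of `T`, the second one moves to the location reached from `q` by reading the label of `s`. The
atomic propositions of the product are the locations of `M`, and `(s, q)` is labelled by `q`. -/
def product (T : LSTS S AP) (M : DMA AP Q) : LSTS (S × Q) Q where
  kernel := (T.kernel.comap Prod.fst measurable_fst) ×ₖ
    (Kernel.deterministic (fun x : S × Q => M.next x.2 (T.label x.1)) (T.measurable_next M))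
  isMarkov := inferInstance
  label x := {x.2}
  measurable_label := by
    have h : Measurable fun q : Q => ({q} : Set Q) := Measurable.of_discrete
    exact h.comp measurable_snd

open scoped Classical in
theorem product_kernel_apply (T : LSTS S AP) (M : DMA AP Q) (s : S) (q q' : Q) {A : Set S} :
    (T.product M).kernel (s, q) (A ×ˢ {q'}) =
      if (q, T.label s, q') ∈ M.edges then T.kernel s A else 0 := by
  simp only [product, Kernel.prod_apply, Measure.prod_prod, Kernel.comap_apply,
    Kernel.deterministic_apply, ← M.next_eq_iff]
  by_cases h : M.next q (T.label s) = q' <;> simp [h]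

/-- The bottom strongly connected component `C` of the graph of `B` (in the product of `T` with
`M`) is good for the acceptance condition of `M`. -/
def IsGood (T : LSTS S AP) (M : DMA AP Q) {B : Set (S × Q)} (C : Set B) : Prop :=
  ((T.product M).graph B).IsBSCC C ∧
    ∃ F ∈ M.acc,
      (∀ s q, (∃ c ∈ C, (T.product M).Reach c (s, q)) → q ∈ F) ∧
      ∀ q ∈ F, ∃ s, ∃ c ∈ C, (T.product M).Reach c (s, q)

end LSTS

end

/-!
Call a path recurrent about a state `a` if all its steps have positive probability and it visits
infinitely often every state reachable from `a`. In a countable chain with a finite attractor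
almost every path is recurrent about some `a`: by the Markov property the attractor is visited
infinitely often, so one of its finitely many points `a` is, and by Lévy's conditional
Borel–Cantelli lemma every successor of a state visited infinitely often is itself visited
infinitely often.

For such a path and any set `B` that can be reached from everywhere, the states of `B` reachable
from `a` form the only BSCC of the graph of `B` that the path visits, and the labels seen infinitely
often are exactly those of the states reachable from this BSCC. So, up to a null set, the Muller
event is the disjoint union of the countably many events of visiting a BSCC whose reachable labels
form an accepting set. Projecting to the first component maps the product chain to the original
one, so that a finite attractor `A` of the latter gives the finite attractor `A ×ˢ univ`.
-/

open Filter Preorder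

theorem map_prodMap_compProd {α β γ δ : Type*} [MeasurableSpace α] [MeasurableSpace β]
    [MeasurableSpace γ] [MeasurableSpace δ] (ν : Measure α) [SFinite ν]
    (κ : Kernel α β) [IsSFiniteKernel κ] (η : Kernel γ δ) [IsSFiniteKernel η]
    {h : α → γ} (hh : Measurable h) {f : β → δ} (hf : Measurable f)
    (hκη : κ.map f = η.comap h hh) :
    (ν ⊗ₘ κ).map (Prod.map h f) = ν.map h ⊗ₘ η := by
  have factor : Prod.map h f = Prod.map h id ∘ Prod.map id f := rfl
  rw [factor, ← Measure.map_map (by fun_prop) (by fun_prop), ← Measure.compProd_map hf, hκη]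
  ext s hs
  rw [Measure.map_apply (by fun_prop) hs,
    Measure.compProd_apply (hs.preimage (by fun_prop)), Measure.compProd_apply hs,
    lintegral_map (Kernel.measurable_kernel_prodMk_left hs) hh]
  rfl

section TrajMeasure

variable {X : ℕ → Type*} [∀ n, MeasurableSpace (X n)]

theorem measure_eq_of_map_frestrictLe_eq {P P' : Measure (Π n, X n)} [IsFiniteMeasure P']
    (h : ∀ n, P.map (frestrictLe n) = P'.map (frestrictLe n)) : P = P' := by
  have hproj : IsProjectiveMeasureFamily fun I : Finset ℕ => P'.map I.restrict :=
    isProjectiveMeasureFamily_map_restrict (X := fun n (x : Π n, X n) => x n)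
      fun n => (measurable_pi_apply n).aemeasurable
  exact ((isProjectiveLimit_nat_iff hproj P).2 h).unique fun _ => rfl

theorem exists_measurable_frestrictLe_zero_eq_comp :
    ∃ g : X 0 → Π i : Finset.Iic 0, X i,
      Measurable g ∧ frestrictLe 0 = g ∘ fun x : Π n, X n => x 0 := by
  refine ⟨(MeasurableEquiv.piUnique fun i : Finset.Iic 0 => X i).symm,
    MeasurableEquiv.measurable _, ?_⟩
  ext x i
  obtain rfl := Subsingleton.elim i default
  rfl

theorem exists_measurable_frestrictLe_succ_eq_comp (n : ℕ) :
    ∃ g : (Π i : Finset.Iic n, X i) × X (n + 1) → Π i : Finset.Iic (n + 1), X i,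
      Measurable g ∧
        frestrictLe (n + 1) = g ∘ fun x : Π n, X n => (frestrictLe n x, x (n + 1)) := by
  refine ⟨IicProdIoc n (n + 1) ∘ Prod.map id (MeasurableEquiv.piSingleton n), by fun_prop, ?_⟩
  ext x ⟨i, hi⟩
  rcases (Finset.mem_Iic.1 hi).lt_or_eq with hlt | rfl
  · simp [IicProdIoc, Nat.lt_succ_iff.1 hlt]
  · simp [IicProdIoc, MeasurableEquiv.piSingleton]

variable (κ : (n : ℕ) → Kernel (Π i : Finset.Iic n, X i) (X (n + 1))) [∀ n, IsMarkovKernel (κ n)]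

theorem map_eval_zero_trajMeasure (μ : Measure (X 0)) :
    (Kernel.trajMeasure μ κ).map (fun x => x 0) = μ := by
  have factor : (fun x : Π n, X n => x 0) =
      (fun h : Π i : Finset.Iic 0, X i => h ⟨0, Finset.mem_Iic.2 le_rfl⟩) ∘ frestrictLe 0 := rfl
  rw [factor, ← Measure.map_map (by fun_prop) (by fun_prop), Kernel.trajMeasure,
    Measure.map_comp _ _ (by fun_prop), Kernel.traj_map_frestrictLe, Kernel.partialTraj_self,
    Measure.id_comp]
  exact MeasurableEquiv.map_map_symm (MeasurableEquiv.piUnique fun i : Finset.Iic 0 => X i)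

theorem eq_trajMeasure {μ : Measure (X 0)} [IsProbabilityMeasure μ] (P : Measure (Π n, X n))
    (hzero : P.map (fun x => x 0) = μ)
    (hstep : ∀ n, P.map (fun x => (frestrictLe n x, x (n + 1))) = P.map (frestrictLe n) ⊗ₘ κ n) :
    P = Kernel.trajMeasure μ κ := by
  refine measure_eq_of_map_frestrictLe_eq fun n => ?_
  induction n with
  | zero =>
    obtain ⟨g, hg, factor⟩ := exists_measurable_frestrictLe_zero_eq_comp (X := X)
    rw [factor, ← Measure.map_map hg (by fun_prop), ← Measure.map_map hg (by fun_prop), hzero,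
      map_eval_zero_trajMeasure]
  | succ n ih =>
    obtain ⟨g, hg, factor⟩ := exists_measurable_frestrictLe_succ_eq_comp (X := X) n
    rw [factor, ← Measure.map_map hg (by fun_prop), ← Measure.map_map hg (by fun_prop), hstep, ih,
      Kernel.map_frestrictLe_trajMeasure_compProd_eq_map_trajMeasure]

end TrajMeasure

namespace LSTS

section PathMeasure

variable {S AP S' AP' : Type*} [MeasurableSpace S] [MeasurableSpace S'] {T : LSTS S AP}
  {T' : LSTS S' AP'}

instance (μ : Measure S) [IsProbabilityMeasure μ] : IsProbabilityMeasure (T.prob μ) := by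
  unfold prob; infer_instance

theorem map_shift_comp_prob {f : S → S'} (hf : Measurable f)
    (hker : T.kernel.map f = T'.kernel.comap f hf) (μ : Measure S) [IsProbabilityMeasure μ]
    (k : ℕ) :
    (T.prob μ).map (fun ρ n => f (ρ (n + k))) = T'.prob ((T.prob μ).map fun ρ => f (ρ k)) := by
  have hfk : Measurable fun ρ : ℕ → S => f (ρ k) := by fun_prop
  have hshift : Measurable fun (ρ : ℕ → S) n => f (ρ (n + k)) := by fun_prop
  have := Measure.isProbabilityMeasure_map (μ := T.prob μ) hfk.aemeasurable
  refine eq_trajMeasure _ _ ?_ fun n => ?_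
  · rw [Measure.map_map (by fun_prop) hshift]
    simp only [Function.comp_def, zero_add]
  let h : (Finset.Iic (n + k) → S) → Finset.Iic n → S' := fun x i =>
    f (x ⟨i + k, Finset.mem_Iic.2 (Nat.add_le_add_right (Finset.mem_Iic.1 i.2) k)⟩)
  have hh : Measurable h := by fun_prop
  have hhistory : (T.historyKernel (n + k)).map f = (T'.historyKernel n).comap h hh := by
    ext x : 1
    simpa only [historyKernel, Kernel.map_apply _ hf, Kernel.comap_apply] using
      DFunLike.congr_fun hker (x ⟨n + k, Finset.mem_Iic.2 le_rfl⟩)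
  have history_next : (fun ρ : ℕ → S' => (frestrictLe (π := fun _ => S') n ρ, ρ (n + 1))) ∘
      (fun (ρ : ℕ → S) n => f (ρ (n + k))) =
      Prod.map h f ∘ fun ρ => (frestrictLe (n + k) ρ, ρ (n + k + 1)) := by
    funext ρ
    simp only [Function.comp_apply, Prod.map, Nat.add_right_comm n 1 k]
    rfl
  have history : frestrictLe (π := fun _ => S') n ∘ (fun (ρ : ℕ → S) n => f (ρ (n + k))) =
      h ∘ frestrictLe (n + k) := rfl
  rw [Measure.map_map (by fun_prop) hshift, Measure.map_map (by fun_prop) hshift, history_next,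
    history, ← Measure.map_map (by fun_prop) (by fun_prop), prob,
    ← Kernel.map_frestrictLe_trajMeasure_compProd_eq_map_trajMeasure,
    map_prodMap_compProd _ _ _ hh hf hhistory, Measure.map_map hh (by fun_prop)]

theorem map_shift_prob (μ : Measure S) [IsProbabilityMeasure μ] (k : ℕ) :
    (T.prob μ).map (fun ρ n => ρ (n + k)) = T.prob ((T.prob μ).map fun ρ => ρ k) :=
  map_shift_comp_prob measurable_id (by rw [Kernel.map_id, Kernel.comap_id]) μ k

theorem map_comp_prob {f : S → S'} (hf : Measurable f)
    (hker : T.kernel.map f = T'.kernel.comap f hf) (μ : Measure S) [IsProbabilityMeasure μ] :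
    (T.prob μ).map (fun ρ n => f (ρ n)) = T'.prob (μ.map f) := by
  have hμ : (T.prob μ).map (fun ρ => f (ρ 0)) = μ.map f := by
    have hzero := map_eval_zero_trajMeasure (X := fun _ => S) T.historyKernel μ
    conv_rhs => rw [← hzero, Measure.map_map hf (by fun_prop)]
    rfl
  rw [← hμ]
  exact map_shift_comp_prob hf hker μ 0

theorem measurableSet_eventually {B : Set S} (hB : MeasurableSet B) :
    MeasurableSet (eventually B) := by
  have : eventually B = ⋃ n, (fun ρ : ℕ → S => ρ n) ⁻¹' B := by
    ext ρ; simp [eventually]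
  rw [this]
  exact MeasurableSet.iUnion fun n => hB.preimage (measurable_pi_apply n)

theorem isAttractor_iff_ae {B : Set S} :
    T.IsAttractor B ↔ MeasurableSet B ∧
      ∀ μ : Measure S, IsProbabilityMeasure μ → ∀ᵐ ρ ∂T.prob μ, ∃ n, ρ n ∈ B :=
  and_congr_right fun hB => forall₂_congr fun _ _ =>
    (mem_ae_iff_prob_eq_one (measurableSet_eventually hB)).symm

theorem IsAttractor.ae_frequently_mem {A : Set S} (hA : T.IsAttractor A) (μ : Measure S)
    [IsProbabilityMeasure μ] : ∀ᵐ ρ ∂T.prob μ, ∃ᶠ n in atTop, ρ n ∈ A := by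
  have hvisit : ∀ k, ∀ᵐ ρ ∂T.prob μ, ∃ n, ρ (n + k) ∈ A := fun k => by
    have hk : Measurable fun ρ : ℕ → S => ρ k := measurable_pi_apply k
    have hshift := (isAttractor_iff_ae.1 hA).2 _
      (Measure.isProbabilityMeasure_map (μ := T.prob μ) hk.aemeasurable)
    rw [← map_shift_prob] at hshift
    have hm : Measurable fun (ρ : ℕ → S) n => ρ (n + k) := by fun_prop
    exact ae_of_ae_map hm.aemeasurable hshift
  filter_upwards [ae_all_iff.2 hvisit] with ρ hρ
  refine frequently_atTop.2 fun k => ?_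
  obtain ⟨n, hn⟩ := hρ k
  exact ⟨n + k, Nat.le_add_left k n, hn⟩

theorem IsAttractor.preimage {A : Set S'} (hA : T'.IsAttractor A) {f : S → S'}
    (hf : Measurable f) (hker : T.kernel.map f = T'.kernel.comap f hf) :
    T.IsAttractor (f ⁻¹' A) := by
  refine isAttractor_iff_ae.2 ⟨hf hA.1, fun μ _ => ?_⟩
  have himage := (isAttractor_iff_ae.1 hA).2 _
    (Measure.isProbabilityMeasure_map (μ := μ) hf.aemeasurable)
  rw [← map_comp_prob hf hker μ] at himage
  have hm : Measurable fun (ρ : ℕ → S) n => f (ρ n) := by fun_prop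
  exact ae_of_ae_map hm.aemeasurable himage

end PathMeasure

section BorelCantelli

variable {S AP : Type*} [MeasurableSpace S] (T : LSTS S AP)

theorem condExp_indicator_succ [StandardBorelSpace S] (μ : Measure S) [IsProbabilityMeasure μ]
    {B : Set S} (hB : MeasurableSet B) (n : ℕ) :
    (T.prob μ)[((fun ρ : ℕ → S => ρ (n + 1)) ⁻¹' B).indicator 1 |
      Filtration.piLE (X := fun _ => S) n] =ᵐ[T.prob μ] fun ρ => (T.kernel (ρ n)).real B := by
  have : Nonempty S := nonempty_of_isProbabilityMeasure μ
  have hhistory : Measurable (frestrictLe (π := fun _ => S) n) := measurable_frestrictLe n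
  rw [Filtration.piLE_eq_comap_frestrictLe]
  filter_upwards [condDistrib_ae_eq_condExp (μ := T.prob μ) hhistory
    (measurable_pi_apply (n + 1)) hB, ae_of_ae_map hhistory.aemeasurable
    (Kernel.condDistrib_trajMeasure (X := fun _ => S) (μ₀ := μ) (κ := T.historyKernel))]
    with ρ hcondExp hcondDistrib
  exact hcondExp.symm.trans (congrArg (fun m : Measure S => m.real B) hcondDistrib)

theorem ae_frequently_mem_iff_tendsto_sum [StandardBorelSpace S] (μ : Measure S)
    [IsProbabilityMeasure μ] {B : Set S} (hB : MeasurableSet B) :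
    ∀ᵐ ρ ∂T.prob μ, (∃ᶠ n in atTop, ρ n ∈ B) ↔
      Tendsto (fun n => ∑ k ∈ Finset.range n, (T.kernel (ρ k)).real B) atTop atTop := by
  have hadapted : ∀ n, MeasurableSet[Filtration.piLE (X := fun _ => S) n]
      ((fun ρ : ℕ → S => ρ n) ⁻¹' B) := fun n => by
    rw [Filtration.piLE_eq_comap_frestrictLe]
    exact ⟨(fun h : Finset.Iic n → S => h ⟨n, Finset.mem_Iic.2 le_rfl⟩) ⁻¹' B,
      hB.preimage (measurable_pi_apply _), rfl⟩
  filter_upwards [ae_mem_limsup_atTop_iff (T.prob μ) hadapted,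
    ae_all_iff.2 (T.condExp_indicator_succ μ hB)] with ρ hlimsup hcondExp
  simpa only [mem_limsup_iff_frequently_mem, Set.mem_preimage, hcondExp] using hlimsup

variable [Countable S] [DiscreteMeasurableSpace S]

theorem ae_kernel_pos (μ : Measure S) [IsProbabilityMeasure μ] :
    ∀ᵐ ρ ∂T.prob μ, ∀ n, 0 < T.kernel (ρ n) {ρ (n + 1)} := by
  refine ae_all_iff.2 fun n => ?_
  have hpos : ∀ s, ∀ᵐ t ∂T.kernel s, 0 < T.kernel s {t} := fun s =>
    ae_iff_of_countable.2 fun _ => pos_iff_ne_zero.2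
  have hlast : Measurable fun p : (Finset.Iic n → S) × S =>
      (p.1 ⟨n, Finset.mem_Iic.2 le_rfl⟩, p.2) := by fun_prop
  have hmeas : MeasurableSet {p : (Finset.Iic n → S) × S |
      0 < T.kernel (p.1 ⟨n, Finset.mem_Iic.2 le_rfl⟩) {p.2}} :=
    (MeasurableSet.of_discrete (s := {p : S × S | 0 < T.kernel p.1 {p.2}})).preimage hlast
  refine ae_of_ae_map (f := fun ρ : ℕ → S => (frestrictLe (π := fun _ => S) n ρ, ρ (n + 1)))
    (by fun_prop) ?_ (p := fun p => 0 < T.kernel (p.1 ⟨n, Finset.mem_Iic.2 le_rfl⟩) {p.2})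
  rw [prob, ← Kernel.map_frestrictLe_trajMeasure_compProd_eq_map_trajMeasure]
  exact Measure.ae_compProd_of_ae_ae hmeas (Eventually.of_forall fun _ => hpos _)

theorem ae_frequently_eq_of_kernel_pos (μ : Measure S) [IsProbabilityMeasure μ] :
    ∀ᵐ ρ ∂T.prob μ, ∀ a b, 0 < T.kernel a {b} →
      (∃ᶠ n in atTop, ρ n = a) → ∃ᶠ n in atTop, ρ n = b := by
  refine ae_all_iff.2 fun a => ae_all_iff.2 fun b => ?_
  filter_upwards [T.ae_frequently_mem_iff_tendsto_sum μ (measurableSet_singleton b)]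
    with ρ hBC hab ha
  -- Each visit to `a` contributes at least `κ a {b} > 0` to the sum of the conditional
  -- probabilities of `b`, which therefore diverges.
  have hvisits : Tendsto (fun n => ∑ k ∈ Finset.range n,
      {k | ρ k = a}.indicator (fun _ => (T.kernel a).real {b}) k) atTop atTop :=
    (Set.infinite_iff_tendsto_sum_indicator_atTop
      (ENNReal.toReal_pos hab.ne' (measure_ne_top _ _))).1 (Nat.frequently_atTop_iff_infinite.1 ha)
  refine hBC.2 (tendsto_atTop_mono (fun n => Finset.sum_le_sum fun k _ => ?_) hvisits)
  exact Set.indicator_apply_le' (fun hk => by rw [show ρ k = a from hk])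
    fun _ => measureReal_nonneg

end BorelCantelli

section Recurrence

variable {S AP : Type*} [MeasurableSpace S] {T : LSTS S AP}

/-- `ρ` is recurrent about `a`: its steps have positive probability and it visits infinitely often
every state reachable from `a`. Almost every path of a countable chain with a finite attractor is
recurrent about some state. -/
structure IsRecurrentPath (T : LSTS S AP) (a : S) (ρ : ℕ → S) : Prop where
  kernel_pos : ∀ n, 0 < T.kernel (ρ n) {ρ (n + 1)}
  frequently_eq : ∀ b, T.Reach a b → ∃ᶠ n in atTop, ρ n = b

/-- The atomic propositions that hold in some state reachable from `C`. For a good BSCC `C` of the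
product with a Muller automaton, this is the unique candidate for the accepting set `F`. -/
def reachableLabels (T : LSTS S AP) (C : Set S) : Set AP :=
  {p | ∃ c ∈ C, ∃ x, T.Reach c x ∧ p ∈ T.label x}

theorem reach_of_le {ρ : ℕ → S} (hρ : ∀ n, 0 < T.kernel (ρ n) {ρ (n + 1)}) {m n : ℕ}
    (h : m ≤ n) : T.Reach (ρ m) (ρ n) := by
  induction n, h using Nat.le_induction with
  | base => exact .refl
  | succ n _ ih => exact ih.tail (hρ n)

theorem reflTransGen_graph_adj_iff {B : Set S} {x y : B} :
    Relation.ReflTransGen (T.graph B).Adj x y ↔ T.Reach x y := by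
  refine ⟨fun h => ?_, fun h => .single h⟩
  induction h with
  | refl => exact .refl
  | tail _ hbc ih => exact ih.trans hbc

theorem isBSCC_graph_iff {B : Set S} {C : Set B} :
    (T.graph B).IsBSCC C ↔ C.Nonempty ∧ ∀ x ∈ C, C = {y : B | T.Reach x y} := by
  simp only [Digraph.IsBSCC, Digraph.IsSCC, reflTransGen_graph_adj_iff]
  constructor
  · rintro ⟨⟨hne, hscc⟩, hbottom⟩
    exact ⟨hne, fun x hx => Set.Subset.antisymm (fun y hy => ((hscc x hx y).1 hy).1) (hbottom x hx)⟩
  · rintro ⟨hne, hC⟩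
    have hmem : ∀ x ∈ C, ∀ y, y ∈ C ↔ T.Reach x y := fun x hx => Set.ext_iff.1 (hC x hx)
    exact ⟨⟨hne, fun x hx y => ⟨fun hy => ⟨(hmem x hx y).1 hy, (hmem y hy x).1 hx⟩,
      fun h => (hmem x hx y).2 h.1⟩⟩, fun x hx y => (hmem x hx y).2⟩

theorem countable_setOf_isBSCC_graph {B : Set S} [Countable B] :
    {C | (T.graph B).IsBSCC C}.Countable := by
  refine (Set.countable_range fun x : B => {y : B | T.Reach x y}).mono fun C hC => ?_
  obtain ⟨⟨x, hx⟩, heq⟩ := isBSCC_graph_iff.1 hC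
  exact ⟨x, (heq x hx).symm⟩

namespace IsRecurrentPath

variable {a : S} {ρ : ℕ → S}

theorem reach (hρ : T.IsRecurrentPath a ρ) (n : ℕ) : T.Reach (ρ n) a := by
  obtain ⟨m, hm, rfl⟩ := frequently_atTop.1 (hρ.frequently_eq a .refl) n
  exact reach_of_le hρ.kernel_pos hm

theorem reach_symm (hρ : T.IsRecurrentPath a ρ) {b : S} (hb : T.Reach a b) : T.Reach b a := by
  obtain ⟨n, rfl⟩ := (hρ.frequently_eq b hb).exists
  exact hρ.reach n

theorem isBSCC_and_mem_eventually_iff (hρ : T.IsRecurrentPath a ρ) {B : Set S}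
    (hB : ∃ b ∈ B, T.Reach a b) {C : Set B} :
    (T.graph B).IsBSCC C ∧ ρ ∈ eventually (Subtype.val '' C) ↔ C = {x : B | T.Reach a x} := by
  obtain ⟨b, hb, hab⟩ := hB
  have hreach : ∀ {x y}, T.Reach a x → (T.Reach x y ↔ T.Reach a y) := fun hx =>
    ⟨hx.trans, (hρ.reach_symm hx).trans⟩
  constructor
  · rintro ⟨hC, n, c, hc, hcn⟩
    obtain ⟨-, hC⟩ := isBSCC_graph_iff.1 hC
    have hbC : (⟨b, hb⟩ : B) ∈ C := by
      rw [hC c hc]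
      exact (hcn ▸ hρ.reach n).trans hab
    simpa only [hreach hab] using hC _ hbC
  · rintro rfl
    refine ⟨isBSCC_graph_iff.2 ⟨⟨⟨b, hb⟩, hab⟩, fun x hx => Set.ext fun y => (hreach hx).symm⟩, ?_⟩
    obtain ⟨n, hn⟩ := (hρ.frequently_eq b hab).exists
    exact ⟨n, ⟨b, hb⟩, hab, hn.symm⟩

theorem inf_eq_reachableLabels (hρ : T.IsRecurrentPath a ρ) {B : Set S}
    (hB : ∃ b ∈ B, T.Reach a b) :
    T.inf ρ = T.reachableLabels (Subtype.val '' {x : B | T.Reach a x}) := by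
  ext p
  simp only [inf, Set.mem_ofPred_eq, ← Nat.frequently_atTop_iff_infinite]
  constructor
  · intro hp
    obtain ⟨b, hb, hab⟩ := hB
    obtain ⟨n, hn⟩ := (hρ.frequently_eq b hab).exists
    obtain ⟨m, hm, hpm⟩ := frequently_atTop.1 hp n
    exact ⟨b, ⟨⟨b, hb⟩, hab, rfl⟩, ρ m, hn ▸ reach_of_le hρ.kernel_pos hm, hpm⟩
  · rintro ⟨_, ⟨c, hc, rfl⟩, x, hcx, hpx⟩
    exact (hρ.frequently_eq x (Relation.ReflTransGen.trans hc hcx)).mono fun n hn => hn ▸ hpx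

end IsRecurrentPath

variable [Countable S] [DiscreteMeasurableSpace S]

theorem IsAttractor.exists_reach {B : Set S} (hB : T.IsAttractor B) (a : S) :
    ∃ b ∈ B, T.Reach a b := by
  have hstart : ∀ᵐ ρ ∂T.prob (Measure.dirac a), ρ 0 = a := by
    have hzero : Measurable fun ρ : ℕ → S => ρ 0 := measurable_pi_apply 0
    refine ae_of_ae_map (p := (· = a)) hzero.aemeasurable ?_
    rw [prob, map_eval_zero_trajMeasure (X := fun _ => S), ae_dirac_eq]
    exact rfl
  have hvisit := (isAttractor_iff_ae.1 hB).2 (Measure.dirac a) inferInstance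
  obtain ⟨ρ, rfl, ⟨n, hn⟩, hpos⟩ :=
    (hstart.and (hvisit.and (T.ae_kernel_pos (Measure.dirac a)))).exists
  exact ⟨ρ n, hn, reach_of_le hpos n.zero_le⟩

theorem IsAttractor.ae_exists_isRecurrentPath {A : Set S} (hA : T.IsAttractor A)
    (hfin : A.Finite) (μ : Measure S) [IsProbabilityMeasure μ] :
    ∀ᵐ ρ ∂T.prob μ, ∃ a, T.IsRecurrentPath a ρ := by
  filter_upwards [hA.ae_frequently_mem μ, T.ae_kernel_pos μ, T.ae_frequently_eq_of_kernel_pos μ]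
    with ρ hρ hpos hsucc
  obtain ⟨a, -, ha⟩ : ∃ a ∈ A, ∃ᶠ n in atTop, ρ n = a :=
    hfin.frequently_exists.1 (hρ.mono fun n hn => ⟨ρ n, hn, rfl⟩)
  refine ⟨a, hpos, fun b hb => ?_⟩
  induction hb with
  | refl => exact ha
  | tail _ hbc ih => exact hsucc _ _ hbc ih

theorem IsAttractor.prob_muller_eq_tsum {A : Set S} (hA : T.IsAttractor A) (hfin : A.Finite)
    {B : Set S} (hB : ∀ a, ∃ b ∈ B, T.Reach a b) (μ : Measure S) [IsProbabilityMeasure μ]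
    (𝓕 : Set (Set AP)) :
    T.prob μ (T.muller 𝓕) =
      ∑' C : {C : Set B // (T.graph B).IsBSCC C ∧ T.reachableLabels (Subtype.val '' C) ∈ 𝓕},
        T.prob μ (eventually (Subtype.val '' C.1)) := by
  have hrec := hA.ae_exists_isRecurrentPath hfin μ
  have : Countable {C : Set B //
      (T.graph B).IsBSCC C ∧ T.reachableLabels (Subtype.val '' C) ∈ 𝓕} :=
    (countable_setOf_isBSCC_graph.mono fun _ hC => hC.1).to_subtype
  rw [← measure_iUnion₀]
  · refine measure_congr ?_
    filter_upwards [hrec] with ρ ⟨a, hρ⟩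
    have hvisited := fun C : Set B => hρ.isBSCC_and_mem_eventually_iff (hB a) (C := C)
    refine propext ?_
    change T.inf ρ ∈ 𝓕 ↔ ρ ∈ ⋃ _, _
    rw [hρ.inf_eq_reachableLabels (hB a), Set.mem_iUnion]
    constructor
    · intro hacc
      obtain ⟨hC, hmem⟩ := (hvisited _).2 rfl
      exact ⟨⟨_, hC, hacc⟩, hmem⟩
    · rintro ⟨⟨C, hC, hacc⟩, hmem⟩
      exact (hvisited C).1 ⟨hC, hmem⟩ ▸ hacc
  · intro C D hCD
    refine measure_mono_null (fun ρ hmem => ?_) hrec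
    rintro ⟨a, hρ⟩
    have hvisited := fun C : Set B => hρ.isBSCC_and_mem_eventually_iff (hB a) (C := C)
    exact hCD (Subtype.ext (((hvisited C).1 ⟨C.2.1, hmem.1⟩).trans
      ((hvisited D).1 ⟨D.2.1, hmem.2⟩).symm))
  · exact fun C => (measurableSet_eventually .of_discrete).nullMeasurableSet

end Recurrence

section Product

variable {S AP Q : Type*} [MeasurableSpace S] [Finite AP]
  [Finite Q] [MeasurableSpace Q] [DiscreteMeasurableSpace Q] (T : LSTS S AP) (M : DMA AP Q)

theorem map_fst_product_kernel :
    (T.product M).kernel.map Prod.fst = T.kernel.comap Prod.fst measurable_fst := by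
  rw [← Kernel.fst_eq]
  exact Kernel.fst_prod _ _

variable {T M}

theorem IsAttractor.preimage_fst {A : Set S} (hA : T.IsAttractor A) :
    (T.product M).IsAttractor (Prod.fst ⁻¹' A) :=
  hA.preimage measurable_fst (T.map_fst_product_kernel M)

theorem isGood_iff {B : Set (S × Q)} {C : Set B} :
    T.IsGood M C ↔ ((T.product M).graph B).IsBSCC C ∧
      (T.product M).reachableLabels (Subtype.val '' C) ∈ M.acc := by
  have mem_reachableLabels : ∀ q, q ∈ (T.product M).reachableLabels (Subtype.val '' C) ↔
      ∃ s, ∃ c ∈ C, (T.product M).Reach c (s, q) := fun q => by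
    constructor
    · rintro ⟨_, ⟨c, hc, rfl⟩, ⟨s, _⟩, hcx, rfl⟩
      exact ⟨s, c, hc, hcx⟩
    · rintro ⟨s, c, hc, hcx⟩
      exact ⟨c, ⟨c, hc, rfl⟩, (s, q), hcx, rfl⟩
  refine and_congr_right fun _ => ⟨?_, fun h => ⟨_, h, ?_, ?_⟩⟩
  · rintro ⟨F, hF, hreach, hF_reach⟩
    convert hF using 1
    ext q
    rw [mem_reachableLabels]
    exact ⟨fun ⟨s, hs⟩ => hreach s q hs, hF_reach q⟩
  · exact fun s q hs => (mem_reachableLabels q).2 ⟨s, hs⟩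
  · exact fun q hq => (mem_reachableLabels q).1 hq

end Product

end LSTS

theorem mainTheorem6 {S AP Q : Type*} [Countable S] [MeasurableSpace S] [DiscreteMeasurableSpace S]
    [Finite AP] [Finite Q] [MeasurableSpace Q] [DiscreteMeasurableSpace Q]
    (T : LSTS S AP) (M : DMA AP Q)
    (hT : ∃ A : Set S, A.Finite ∧ T.IsAttractor A) :
    (∃ B : Set (S × Q), B.Finite ∧ (T.product M).IsAttractor B) ∧
    ∀ B : Set (S × Q), (T.product M).IsAttractor B →
      ∀ μ : Measure S, IsProbabilityMeasure μ →
        (T.product M).prob (μ.prod (Measure.dirac M.init)) ((T.product M).muller M.acc) =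
          ∑' C : {C : Set B // T.IsGood M C},
            (T.product M).prob (μ.prod (Measure.dirac M.init))
              (LSTS.eventually (Subtype.val '' C.1)) := by
  obtain ⟨A, hfin, hA⟩ := hT
  have hA' : (T.product M).IsAttractor (Prod.fst ⁻¹' A) := hA.preimage_fst
  have hfin' : (Prod.fst ⁻¹' A : Set (S × Q)).Finite := by
    rw [← Set.prod_univ]
    exact hfin.prod Set.finite_univ
  refine ⟨⟨_, hfin', hA'⟩, fun B hB μ _ => ?_⟩
  rw [hA'.prob_muller_eq_tsum hfin' hB.exists_reach]
  exact ((Equiv.subtypeEquivRight fun _ => LSTS.isGood_iff).tsum_eq _).symm
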